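/- Let $(X,\rho,\mu)$ be a quasi-metric measure space: $X$ is a set with at least two points; $\rho:X\times X\to[0,\infty)$ satisfies $\rho(x,y)=0\iff x=y$, $\rho(y,x)\le C_0\,\rho(x,y)$ and $\rho(x,y)\le C_1\max\{\rho(x,z),\rho(z,y)\}$ for all $x,y,z\in X$, with positive constants $C_0,C_1$; and $\mu$ is a nonnegative Borel measure (with respect to the topology in which $O\subset X$ is open iff every $x\in O$ has a ball $B_\rho(x,r)\subset O$ with $r>0$) such that every ball $B_\rho(x,r):=\{y\in X:\rho(x,y)<r\}$, $x\in X$, $r\in(0,\infty)$, is $\mu$-measurable with $\mu(B_\rho(x,r))\in(0,\infty)$. Put ${\rm diam}_\rho(X):=\sup_{x,y\in X}\rho(x,y)$. The H\"older index ${\rm ind}_H(X,\rho)\in[0,\infty]$ is the infimum (with $\inf\emptyset:=\infty$) of all $\alpha\in(0,\infty)$ such that for all $x,y\in X$ and all $\varepsilon>0$ there are $N\in\mathbb{N}=\{1,2,\dots\}$ and $\xi_1,\dots,\xi_{N+1}\in X$ with $\xi_1=x$, $\xi_{N+1}=y$ and $\sum_{i=1}^N[\rho(\xi_i,\xi_{i+1})]^\alpha<\varepsilon$.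 For $s\in(0,\infty)$, a fractional $s$-gradient of a $\mu$-measurable function $u:X\to\mathbb{R}$ is a sequence $\vec g=\{g_k\}_{k\in\mathbb{Z}}$ of nonnegative $\mu$-measurable functions on $X$ for which there is a set $E$ with $\mu(E)=0$ such that $|u(x)-u(y)|\le[\rho(x,y)]^s[g_k(x)+g_k(y)]$ for all $k\in\mathbb{Z}$ and all $x,y\in X\setminus E$ with $2^{-k-1}\le\rho(x,y)<2^{-k}$. For $p\in(0,\infty)$ and $q\in(0,\infty]$, let $\dot M^s_{p,q}(X,\rho,\mu)$ (respectively, $\dot N^s_{p,q}(X,\rho,\mu)$) be the set of all $\mu$-measurable $u:X\to\mathbb{R}$ for which the infimum, over all fractional $s$-gradients $\vec g$ of $u$, of $\big\|\,\|\{g_k\}_{k\in\mathbb{Z}}\|_{\ell^q}\big\|_{L^p(X,\mu)}$ (respectively, of $\big\|\{\|g_k\|_{L^p(X,\mu)}\}_{k\in\mathbb{Z}}\big\|_{\ell^q}$) is finite, with $\inf\emptyset:=\infty$. Theorem. Suppose that there are positive constants $\kappa$ and $Q$ such that $$\kappa\,r^Q\le\mu(B_\rho(x,r))\quad\text{for any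 }x\in X\text{ and any finite }r\in(0,{\rm diam}_\rho(X)].$$ Then, whenever $s\in({\rm ind}_H(X,\rho),\infty)$, $p\in\big(Q/[s-{\rm ind}_H(X,\rho)],\infty\big)$ and $q\in(0,\infty]$, both $\dot M^s_{p,q}(X,\rho,\mu)$ and $\dot N^s_{p,q}(X,\rho,\mu)$ are trivial: every function in either of them coincides $\mu$-almost everywhere on $X$ with a constant. -/

import Mathlib

open MeasureTheory
open scoped ENNReal

noncomputable section

namespace QuasiMetric

variable {X : Type*}

/-- `ρ : X × X → [0, ∞)` is a quasi-metric (not necessarily symmetric). -/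
structure IsQuasiMetric (ρ : X → X → ℝ) : Prop where
  nonneg : ∀ x y, 0 ≤ ρ x y
  eq_zero_iff : ∀ x y, ρ x y = 0 ↔ x = y
  quasi_symm : ∃ C₀ : ℝ, 0 < C₀ ∧ ∀ x y, ρ y x ≤ C₀ * ρ x y
  quasi_triangle : ∃ C₁ : ℝ, 0 < C₁ ∧ ∀ x y z, ρ x y ≤ C₁ * max (ρ x z) (ρ z y)

/-- The ball `B_ρ(x, r) = {y : ρ(x, y) < r}`; the order of `x` and `y` matters. -/
def ball (ρ : X → X → ℝ) (x : X) (r : ℝ) : Set X := {y | ρ x y < r}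

/-- `diam_ρ(X) ∈ [0, ∞]`. -/
def diam (ρ : X → X → ℝ) : ℝ≥0∞ := ⨆ (x : X) (y : X), ENNReal.ofReal (ρ x y)

/-- The canonical topology `τ_ρ`: a set is open iff with each of its points it contains a
`ρ`-ball centred at that point (balls themselves need not be open). -/
abbrev topology (ρ : X → X → ℝ) : TopologicalSpace X where
  IsOpen U := ∀ x ∈ U, ∃ r : ℝ, 0 < r ∧ ball ρ x r ⊆ U
  isOpen_univ := fun _ _ => ⟨1, one_pos, Set.subset_univ _⟩
  isOpen_inter := by
    rintro U V hU hV x ⟨hxU, hxV⟩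
    obtain ⟨r, hr, hrU⟩ := hU x hxU
    obtain ⟨t, ht, htV⟩ := hV x hxV
    refine ⟨min r t, lt_min hr ht, fun y hy => ⟨hrU ?_, htV ?_⟩⟩
    · exact lt_of_lt_of_le (show ρ x y < min r t from hy) (min_le_left _ _)
    · exact lt_of_lt_of_le (show ρ x y < min r t from hy) (min_le_right _ _)
  isOpen_sUnion := by
    rintro S hS x ⟨U, hU, hxU⟩
    obtain ⟨r, hr, hrU⟩ := hS U hU x hxU
    exact ⟨r, hr, hrU.trans (Set.subset_sUnion_of_mem hU)⟩

/-- `(X, ρ, μ)` is a quasi-metric measure space: `X` has at least two points, `ρ` is a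
quasi-metric, `μ` is a Borel measure (its σ-algebra contains the Borel sets of `τ_ρ`), and all
`ρ`-balls are `μ`-measurable and have measure in `(0, ∞)`. -/
structure IsQuasiMetricMeasureSpace [MeasurableSpace X] (ρ : X → X → ℝ) (μ : Measure X) :
    Prop where
  nontrivial : Nontrivial X
  isQuasiMetric : IsQuasiMetric ρ
  borel_le : @borel X (topology ρ) ≤ ‹MeasurableSpace X›
  nullMeasurableSet_ball : ∀ (x : X) (r : ℝ), 0 < r → NullMeasurableSet (ball ρ x r) μ
  measure_ball_pos : ∀ (x : X) (r : ℝ), 0 < r → 0 < μ (ball ρ x r)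
  measure_ball_lt_top : ∀ (x : X) (r : ℝ), 0 < r → μ (ball ρ x r) < ∞

/-- `μ` is lower `Q`-Ahlfors-regular: `κ r ^ Q ≤ μ(B_ρ(x, r))` for all `x` and all finite
`r ∈ (0, diam_ρ(X)]`. -/
def LowerAhlforsRegular [MeasurableSpace X] (ρ : X → X → ℝ) (μ : Measure X) (Q : ℝ) : Prop :=
  ∃ κ : ℝ, 0 < κ ∧ ∀ (x : X) (r : ℝ), 0 < r → ENNReal.ofReal r ≤ diam ρ →
    ENNReal.ofReal (κ * r ^ Q) ≤ μ (ball ρ x r)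

/-- Any two points are joined by finite chains with arbitrarily small `∑ ρ(ξᵢ, ξᵢ₊₁) ^ α`. -/
def HasSmallChains (ρ : X → X → ℝ) (α : ℝ) : Prop :=
  ∀ (x y : X) (ε : ℝ), 0 < ε → ∃ (N : ℕ) (ξ : ℕ → X), 1 ≤ N ∧ ξ 0 = x ∧ ξ N = y ∧
    ∑ i ∈ Finset.range N, ρ (ξ i) (ξ (i + 1)) ^ α < ε

/-- The Hölder index `ind_H(X, ρ) ∈ [0, ∞]`, with `inf ∅ = ∞`. -/
def holderIndex (ρ : X → X → ℝ) : ℝ≥0∞ :=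
  ⨅ (α : ℝ) (_ : 0 < α) (_ : HasSmallChains ρ α), ENNReal.ofReal α

/-- The `ℓ^q` (quasi-)norm of a sequence of elements of `[0, ∞]` indexed by `ℤ`, `0 < q ≤ ∞`. -/
def lqNorm (q : ℝ≥0∞) (a : ℤ → ℝ≥0∞) : ℝ≥0∞ :=
  if q = ∞ then ⨆ k, a k else (∑' k, a k ^ q.toReal) ^ (1 / q.toReal)

variable [MeasurableSpace X]

/-- `g = (g_k)` is a fractional `s`-gradient of `u`. The `g_k` may take the value `∞`; when one
of the norms below is finite they are finite almost everywhere, so that this gives the same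
spaces and norms as finite-valued `g_k`. -/
def IsFractionalGradient (ρ : X → X → ℝ) (μ : Measure X) (s : ℝ) (u : X → ℝ)
    (g : ℤ → X → ℝ≥0∞) : Prop :=
  (∀ k, AEMeasurable (g k) μ) ∧
  ∃ E : Set X, μ E = 0 ∧ ∀ (k : ℤ) (x y : X), x ∉ E → y ∉ E →
    (2 : ℝ) ^ (-k - 1) ≤ ρ x y → ρ x y < (2 : ℝ) ^ (-k) →
      ENNReal.ofReal |u x - u y| ≤ ENNReal.ofReal (ρ x y ^ s) * (g k x + g k y)

/-- `‖g‖_{L^p(X, ℓ^q)}`. -/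
def normLpLq (μ : Measure X) (p : ℝ) (q : ℝ≥0∞) (g : ℤ → X → ℝ≥0∞) : ℝ≥0∞ :=
  eLpNorm (fun x => lqNorm q (fun k => g k x)) (ENNReal.ofReal p) μ

/-- `‖g‖_{ℓ^q(L^p(X))}`. -/
def normLqLp (μ : Measure X) (p : ℝ) (q : ℝ≥0∞) (g : ℤ → X → ℝ≥0∞) : ℝ≥0∞ :=
  lqNorm q (fun k => eLpNorm (g k) (ENNReal.ofReal p) μ)

/-- The homogeneous Hajłasz–Triebel–Lizorkin space `Ṁ^s_{p,q}(X, ρ, μ)`. -/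
def HajlaszTriebelLizorkin (ρ : X → X → ℝ) (μ : Measure X) (s p : ℝ) (q : ℝ≥0∞) :
    Set (X → ℝ) :=
  {u | AEMeasurable u μ ∧
    (⨅ (g : ℤ → X → ℝ≥0∞) (_ : IsFractionalGradient ρ μ s u g), normLpLq μ p q g) < ∞}

/-- The homogeneous Hajłasz–Besov space `Ṅ^s_{p,q}(X, ρ, μ)`. -/
def HajlaszBesov (ρ : X → X → ℝ) (μ : Measure X) (s p : ℝ) (q : ℝ≥0∞) : Set (X → ℝ) :=
  {u | AEMeasurable u μ ∧
    (⨅ (g : ℤ → X → ℝ≥0∞) (_ : IsFractionalGradient ρ μ s u g), normLqLp μ p q g) < ∞}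

end QuasiMetric

end

/-! Both quasi-norms dominate `sup_k ‖g_k‖_{L^p}`, so it suffices to treat a gradient bounded in
`L^p` uniformly in `k`. By Chebyshev, outside a set of measure at most `(κ/2) 2^(-mQ)`, all `g_k` at
scales up to about `2^(-m)` obey a bound of order `2^(mQ/p)`, up to a factor growing geometrically
with `k` (`exists_measure_compl_goodSet_le`). Such an exceptional set is too small to contain a ball
of radius `2^(-m)`, so good points lie near every point. Between nearby good points `u` varies by at
most a multiple of `2^(-mσ)`, where `σ = s - Q/p`. Chaining through good points of successive scales
makes `u` locally `σ`-Hölder on a set of full measure (`exists_holder_of_scales`, Borel–Cantelli).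
The hypothesis on `p` says that `σ` exceeds the Hölder index, so chains with small `∑ ρ^α` exist for
some `α < σ`; moved into the full-measure set, they force `u` to be constant there
(`eq_of_holder_of_hasSmallChains`). -/

namespace QuasiMetric

/-! ### Small chains and Hölder functions. -/

section Chains

variable {X : Type*} {ρ : X → X → ℝ}

/-- The quasi-triangle inequality for a pair of points close to another pair of points. -/
theorem IsQuasiMetric.exists_dist_le_of_near (hρ : IsQuasiMetric ρ) :
    ∃ D : ℝ, 0 < D ∧ ∀ (x x' y y' : X) (t : ℝ), ρ x x' ≤ t → ρ x y ≤ t → ρ y y' ≤ t →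
      ρ x' y' ≤ D * t := by
  obtain ⟨C₀, hC₀, h₀⟩ := hρ.quasi_symm
  obtain ⟨C₁, hC₁, h₁⟩ := hρ.quasi_triangle
  refine ⟨C₁ * max C₀ C₁, by positivity, fun x x' y y' t hxx hxy hyy => ?_⟩
  have ht : 0 ≤ t := (hρ.nonneg x x').trans hxx
  have e₁ : ρ x' x ≤ max C₀ C₁ * t := by
    calc ρ x' x ≤ C₀ * ρ x x' := h₀ _ _
      _ ≤ C₀ * t := by gcongr
      _ ≤ max C₀ C₁ * t := by gcongr; exact le_max_left _ _
  have e₂ : ρ x y' ≤ max C₀ C₁ * t := by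
    calc ρ x y' ≤ C₁ * max (ρ x y) (ρ y y') := h₁ _ _ _
      _ ≤ C₁ * t := by gcongr; exact max_le hxy hyy
      _ ≤ max C₀ C₁ * t := by gcongr; exact le_max_right _ _
  calc ρ x' y' ≤ C₁ * max (ρ x' x) (ρ x y') := h₁ _ _ _
    _ ≤ C₁ * (max C₀ C₁ * t) := by gcongr; exact max_le e₁ e₂
    _ = C₁ * max C₀ C₁ * t := by ring

/-- Small chains can be chosen inside any set that meets all balls. -/
theorem HasSmallChains.exists_chain_mem (hρ : IsQuasiMetric ρ) {α : ℝ} (hα : 0 < α)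
    (hc : HasSmallChains ρ α) {S : Set X} (hS : ∀ x r, 0 < r → ∃ y ∈ S, ρ x y < r)
    {x y : X} (hx : x ∈ S) (hy : y ∈ S) {ε : ℝ} (hε : 0 < ε) :
    ∃ (N : ℕ) (ξ : ℕ → X), ξ 0 = x ∧ ξ N = y ∧ (∀ i, ξ i ∈ S) ∧
      ∑ i ∈ Finset.range N, ρ (ξ i) (ξ (i + 1)) ^ α < ε := by
  obtain ⟨D, hD, hnear⟩ := hρ.exists_dist_le_of_near
  have hDα : 0 < D ^ α := Real.rpow_pos_of_pos hD α
  -- One `η` pays for the original chain, another for moving its points.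
  set η : ℝ := ε / (2 * D ^ α) with hη
  have hηpos : 0 < η := by positivity
  obtain ⟨N, ξ, hN, h0, hNy, hsum⟩ := hc x y η hηpos
  have hNpos : (0 : ℝ) < N := by exact_mod_cast hN
  -- The displacement is chosen so that `N * t ^ α = η`.
  set t : ℝ := (η / N) ^ (1 / α) with ht
  have htpos : 0 < t := by positivity
  have htα : t ^ α = η / N := by
    rw [ht, ← Real.rpow_mul (by positivity), one_div_mul_cancel hα.ne', Real.rpow_one]
  -- Points already in `S` stay put, which preserves the endpoints.
  have hex : ∀ i, ∃ z ∈ S, ρ (ξ i) z ≤ t ∧ (ξ i ∈ S → z = ξ i) := by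
    intro i
    by_cases h : ξ i ∈ S
    · exact ⟨ξ i, h, by rw [(hρ.eq_zero_iff _ _).2 rfl]; exact htpos.le, fun _ => rfl⟩
    · obtain ⟨z, hz, hzt⟩ := hS (ξ i) t htpos
      exact ⟨z, hz, hzt.le, fun h' => (h h').elim⟩
  choose ζ hζS hζt hζeq using hex
  refine ⟨N, ζ, ?_, ?_, hζS, ?_⟩
  · rw [hζeq 0 (h0 ▸ hx), h0]
  · rw [hζeq N (hNy ▸ hy), hNy]
  have hstep : ∀ i, ρ (ζ i) (ζ (i + 1)) ^ α ≤ D ^ α * (ρ (ξ i) (ξ (i + 1)) ^ α + η / N) := by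
    intro i
    have hn := hρ.nonneg (ξ i) (ξ (i + 1))
    have h := hnear (ξ i) (ζ i) (ξ (i + 1)) (ζ (i + 1)) (max (ρ (ξ i) (ξ (i + 1))) t)
      ((hζt i).trans (le_max_right _ _)) (le_max_left _ _) ((hζt _).trans (le_max_right _ _))
    calc ρ (ζ i) (ζ (i + 1)) ^ α ≤ (D * max (ρ (ξ i) (ξ (i + 1))) t) ^ α :=
          Real.rpow_le_rpow (hρ.nonneg _ _) h hα.le
      _ = D ^ α * (max (ρ (ξ i) (ξ (i + 1))) t) ^ α :=
          Real.mul_rpow hD.le (hn.trans (le_max_left _ _))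
      _ ≤ D ^ α * (ρ (ξ i) (ξ (i + 1)) ^ α + η / N) := by
          gcongr
          rw [← htα]
          have a₁ : 0 ≤ ρ (ξ i) (ξ (i + 1)) ^ α := Real.rpow_nonneg hn α
          have a₂ : 0 ≤ t ^ α := Real.rpow_nonneg htpos.le α
          rcases max_choice (ρ (ξ i) (ξ (i + 1))) t with h | h <;> rw [h] <;> linarith
  calc ∑ i ∈ Finset.range N, ρ (ζ i) (ζ (i + 1)) ^ α
      ≤ ∑ i ∈ Finset.range N, D ^ α * (ρ (ξ i) (ξ (i + 1)) ^ α + η / N) :=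
        Finset.sum_le_sum fun i _ => hstep i
    _ = D ^ α * (∑ i ∈ Finset.range N, ρ (ξ i) (ξ (i + 1)) ^ α + η) := by
        rw [← Finset.mul_sum, Finset.sum_add_distrib]
        simp only [Finset.sum_const, Finset.card_range, nsmul_eq_mul]
        rw [mul_div_cancel₀ _ hNpos.ne']
    _ < D ^ α * (η + η) := by gcongr
    _ = ε := by rw [hη]; field_simp; norm_num

/-- A function that is locally uniformly Hölder continuous of an order above `α` on a set meeting
all balls is constant there, if small `α`-chains exist. -/
theorem eq_of_holder_of_hasSmallChains (hρ : IsQuasiMetric ρ) {α σ : ℝ} (hα : 0 < α)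
    (hασ : α ≤ σ) (hc : HasSmallChains ρ α) {S : Set X}
    (hS : ∀ x r, 0 < r → ∃ y ∈ S, ρ x y < r) {u : X → ℝ} {C r : ℝ} (hC : 0 ≤ C) (hr : 0 < r)
    (hu : ∀ x ∈ S, ∀ y ∈ S, ρ x y < r → |u x - u y| ≤ C * ρ x y ^ σ)
    {x y : X} (hx : x ∈ S) (hy : y ∈ S) : u x = u y := by
  have key : ∀ ε : ℝ, 0 < ε → |u x - u y| ≤ C * ε := by
    intro ε hε
    -- A sum below `r' ^ α` makes every step shorter than `r'`; the cap at 1 gives `ρ ^ σ ≤ ρ ^ α`.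
    set r' : ℝ := min r 1
    have hr' : 0 < r' := lt_min hr one_pos
    obtain ⟨N, ξ, h0, hN, hξ, hsum⟩ := hc.exists_chain_mem hρ hα hS hx hy
      (lt_min hε (Real.rpow_pos_of_pos hr' α))
    have hsmall : ∀ i ∈ Finset.range N, ρ (ξ i) (ξ (i + 1)) < r' := by
      intro i hi
      have h1 : ρ (ξ i) (ξ (i + 1)) ^ α ≤ ∑ i ∈ Finset.range N, ρ (ξ i) (ξ (i + 1)) ^ α :=
        Finset.single_le_sum (f := fun i => ρ (ξ i) (ξ (i + 1)) ^ α)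
          (fun j _ => Real.rpow_nonneg (hρ.nonneg _ _) α) hi
      exact (Real.rpow_lt_rpow_iff (hρ.nonneg _ _) hr'.le hα).1
        ((h1.trans_lt hsum).trans_le (min_le_right _ _))
    calc |u x - u y| = dist (u (ξ 0)) (u (ξ N)) := by rw [h0, hN, Real.dist_eq]
      _ ≤ ∑ i ∈ Finset.range N, dist (u (ξ i)) (u (ξ (i + 1))) :=
          dist_le_range_sum_dist (fun i => u (ξ i)) N
      _ ≤ ∑ i ∈ Finset.range N, C * ρ (ξ i) (ξ (i + 1)) ^ α := by
          refine Finset.sum_le_sum fun i hi => ?_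
          have hi' := hsmall i hi
          rw [Real.dist_eq]
          refine (hu _ (hξ i) _ (hξ _) (hi'.trans_le (min_le_left _ _))).trans ?_
          refine mul_le_mul_of_nonneg_left ?_ hC
          rcases (hρ.nonneg (ξ i) (ξ (i + 1))).eq_or_lt with h | h
          · rw [← h, Real.zero_rpow hα.ne', Real.zero_rpow (hα.trans_le hασ).ne']
          · exact Real.rpow_le_rpow_of_exponent_ge h (hi'.le.trans (min_le_right _ _)) hασ
      _ = C * ∑ i ∈ Finset.range N, ρ (ξ i) (ξ (i + 1)) ^ α := by rw [Finset.mul_sum]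
      _ ≤ C * ε := by gcongr; exact hsum.le.trans (min_le_left _ _)
  by_contra hne
  have hpos : 0 < |u x - u y| := abs_pos.2 (sub_ne_zero.2 hne)
  have h := key (|u x - u y| / (2 * (C + 1))) (by positivity)
  have : C * (|u x - u y| / (2 * (C + 1))) < |u x - u y| := by
    rw [← mul_div_assoc, div_lt_iff₀ (by positivity)]
    nlinarith
  linarith

end Chains

/-! ### Good sets of a fractional gradient. -/

section Gradient

variable {X : Type*} {ρ : X → X → ℝ}

/-- The points outside `E` at which the functions `g k`, `k ≥ m - b`, obey a bound adapted to
the scale `2 ^ (-m)`. -/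
def goodSet (g : ℤ → X → ℝ≥0∞) (E : Set X) (s τ A : ℝ) (b m : ℕ) : Set X :=
  {y | y ∉ E ∧ ∀ i : ℕ, g ((m : ℤ) - b + i) y ≤
    ENNReal.ofReal (A * ((2 : ℝ) ^ i) ^ s * ((2 : ℝ) ^ m) ^ τ)}

/-- The bound on `d` forces `k ≥ m - b`, so `k` is a controlled index `m - b + i`. The growth `2 ^
(i s)` allowed there is absorbed by `d ^ s ≤ 2 ^ ((b - m - i) s)`. -/
theorem ofReal_rpow_mul_le_of_mem_goodSet {g : ℤ → X → ℝ≥0∞} {E : Set X} {s τ A : ℝ}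
    (hs : 0 ≤ s) {b m : ℕ} {y : X} (hy : y ∈ goodSet g E s τ A b m)
    {d : ℝ} {k : ℤ} (hd₁ : (2 : ℝ) ^ (-k - 1) ≤ d) (hd₂ : d < (2 : ℝ) ^ (-k))
    (hd₃ : d < 2 ^ b / 2 ^ m) :
    ENNReal.ofReal (d ^ s) * g k y ≤
      ENNReal.ofReal (A * ((2 : ℝ) ^ b) ^ s * ((2 : ℝ) ^ m) ^ (τ - s)) := by
  have hd : 0 ≤ d := le_trans (by positivity) hd₁
  have hk : -k - 1 < (b : ℤ) - m := by
    have h := hd₁.trans_lt hd₃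
    rw [← zpow_natCast, ← zpow_natCast, ← zpow_sub₀ two_ne_zero] at h
    exact (zpow_lt_zpow_iff_right₀ one_lt_two).1 h
  obtain ⟨i, hi⟩ := Int.eq_ofNat_of_zero_le (show 0 ≤ k - ((m : ℤ) - b) by omega)
  have hk' : k = (m : ℤ) - b + i := by omega
  have hdi : d ≤ 2 ^ b / (2 ^ m * 2 ^ i) := by
    refine hd₂.le.trans_eq ?_
    rw [hk', show -((m : ℤ) - b + i) = b - (m + i) by ring, zpow_sub₀ two_ne_zero,
      zpow_add₀ two_ne_zero]
    simp only [zpow_natCast]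
  have hg := hy.2 i
  rw [← hk'] at hg
  calc ENNReal.ofReal (d ^ s) * g k y
      ≤ ENNReal.ofReal (((2 : ℝ) ^ b / (2 ^ m * 2 ^ i)) ^ s) *
          ENNReal.ofReal (A * ((2 : ℝ) ^ i) ^ s * ((2 : ℝ) ^ m) ^ τ) := by
        gcongr
    _ = ENNReal.ofReal (((2 : ℝ) ^ b / (2 ^ m * 2 ^ i)) ^ s *
          (A * ((2 : ℝ) ^ i) ^ s * ((2 : ℝ) ^ m) ^ τ)) :=
        (ENNReal.ofReal_mul (by positivity)).symm
    _ = _ := by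
        congr 1
        rw [Real.div_rpow (by positivity) (by positivity),
          Real.mul_rpow (by positivity) (by positivity), Real.rpow_sub (by positivity)]
        have h1 : (0 : ℝ) < ((2 : ℝ) ^ i) ^ s := by positivity
        have h2 : (0 : ℝ) < ((2 : ℝ) ^ m) ^ s := by positivity
        field_simp

/-- Two levels are allowed because the chaining passes from level `m` to `m + 1`. -/
theorem abs_sub_le_of_mem_goodSet (hρ : IsQuasiMetric ρ) {u : X → ℝ} {g : ℤ → X → ℝ≥0∞}
    {E : Set X} {s τ A : ℝ} (hs : 0 ≤ s) (hA : 0 ≤ A)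
    (hE : ∀ (k : ℤ) (x y : X), x ∉ E → y ∉ E →
      (2 : ℝ) ^ (-k - 1) ≤ ρ x y → ρ x y < (2 : ℝ) ^ (-k) →
      ENNReal.ofReal |u x - u y| ≤ ENNReal.ofReal (ρ x y ^ s) * (g k x + g k y))
    {b m n : ℕ} {x y : X} (hx : x ∈ goodSet g E s τ A b m) (hy : y ∈ goodSet g E s τ A b n)
    (hm : ρ x y < 2 ^ b / 2 ^ m) (hn : ρ x y < 2 ^ b / 2 ^ n) :
    |u x - u y| ≤ A * ((2 : ℝ) ^ b) ^ s * ((2 : ℝ) ^ m) ^ (τ - s) +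
      A * ((2 : ℝ) ^ b) ^ s * ((2 : ℝ) ^ n) ^ (τ - s) := by
  rcases (hρ.nonneg x y).eq_or_lt with h | h
  · rw [(hρ.eq_zero_iff x y).1 h.symm, sub_self, abs_zero]
    positivity
  obtain ⟨j, hj₁, hj₂⟩ := exists_mem_Ico_zpow h one_lt_two
  obtain ⟨k, rfl⟩ : ∃ k : ℤ, j = -k - 1 := ⟨-j - 1, by ring⟩
  rw [sub_add_cancel] at hj₂
  have h1 := hE k x y hx.1 hy.1 hj₁ hj₂
  rw [mul_add] at h1
  have h2 := h1.trans (add_le_add (ofReal_rpow_mul_le_of_mem_goodSet hs hx hj₁ hj₂ hm)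
    (ofReal_rpow_mul_le_of_mem_goodSet hs hy hj₁ hj₂ hn))
  rwa [← ENNReal.ofReal_add (by positivity) (by positivity),
    ENNReal.ofReal_le_ofReal_iff (by positivity)] at h2

variable [MeasurableSpace X] {μ : Measure X}

/-- Chebyshev's inequality for a function with bounded `L^p` norm. -/
theorem measure_ofReal_lt_le {f : X → ℝ≥0∞} (hf : AEMeasurable f μ) {p M t : ℝ} (hp : 0 < p)
    (hM : 0 ≤ M) (ht : 0 < t) (hfM : eLpNorm f (ENNReal.ofReal p) μ ≤ ENNReal.ofReal M) :
    μ {x | ENNReal.ofReal t < f x} ≤ ENNReal.ofReal ((M / t) ^ p) := by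
  have hp0 : ENNReal.ofReal p ≠ 0 := (ENNReal.ofReal_pos.2 hp).ne'
  have hI : ∫⁻ x, f x ^ p ∂μ ≤ ENNReal.ofReal (M ^ p) := by
    rw [eLpNorm_eq_lintegral_rpow_enorm_toReal hp0 ENNReal.ofReal_ne_top,
      ENNReal.toReal_ofReal hp.le] at hfM
    simp only [enorm_eq_self] at hfM
    have h := ENNReal.rpow_le_rpow hfM hp.le
    rwa [← ENNReal.rpow_mul, one_div_mul_cancel hp.ne', ENNReal.rpow_one,
      ENNReal.ofReal_rpow_of_nonneg hM hp.le] at h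
  have htp : (0 : ℝ) < t ^ p := Real.rpow_pos_of_pos ht p
  calc μ {x | ENNReal.ofReal t < f x}
      ≤ μ {x | ENNReal.ofReal (t ^ p) ≤ f x ^ p} := by
        refine measure_mono fun x hx => ?_
        have h := ENNReal.rpow_le_rpow (le_of_lt (show ENNReal.ofReal t < f x from hx)) hp.le
        rwa [ENNReal.ofReal_rpow_of_nonneg ht.le hp.le] at h
    _ ≤ (∫⁻ x, f x ^ p ∂μ) / ENNReal.ofReal (t ^ p) :=
        meas_ge_le_lintegral_div (hf.pow_const p) (ENNReal.ofReal_pos.2 htp).ne'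
          ENNReal.ofReal_ne_top
    _ ≤ ENNReal.ofReal (M ^ p) / ENNReal.ofReal (t ^ p) := by gcongr
    _ = ENNReal.ofReal ((M / t) ^ p) := by
        rw [← ENNReal.ofReal_div_of_pos htp, Real.div_rpow hM ht.le]

/-- For a suitable constant `A`, the complements of the good sets are small. -/
theorem exists_measure_compl_goodSet_le {g : ℤ → X → ℝ≥0∞} (hg : ∀ k, AEMeasurable (g k) μ)
    {E : Set X} (hE : μ E = 0) {s p Q M κ : ℝ} (hs : 0 < s) (hp : 0 < p) (hM : 0 < M)
    (hκ : 0 < κ) (hgM : ∀ k, eLpNorm (g k) (ENNReal.ofReal p) μ ≤ ENNReal.ofReal M) (b : ℕ) :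
    ∃ A : ℝ, 0 < A ∧ ∀ m : ℕ, μ (goodSet g E s (Q / p) A b m)ᶜ ≤
      ENNReal.ofReal (κ * ((2 : ℝ) ^ m) ^ (-Q)) := by
  set θ : ℝ := (2 : ℝ) ^ (-(s * p)) with hθ
  have hθ0 : 0 < θ := by positivity
  have hθ1 : θ < 1 := Real.rpow_lt_one_of_one_lt_of_neg one_lt_two (by
    have := mul_pos hs hp; linarith)
  have h1θ : 0 < 1 - θ := by linarith
  -- This value gives `(M / A) ^ p = κ * (1 - θ)`, and `1 - θ` cancels the sum of the geometric
  -- series over `i`.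
  refine ⟨M * (κ * (1 - θ)) ^ (-(1 / p)), by positivity, fun m => ?_⟩
  set A : ℝ := M * (κ * (1 - θ)) ^ (-(1 / p)) with hA
  have hApos : 0 < A := by positivity
  have hAp : (M / A) ^ p = κ * (1 - θ) := by
    rw [hA, Real.rpow_neg (by positivity), ← div_eq_mul_inv, div_div_cancel₀ hM.ne',
      ← Real.rpow_mul (by positivity), one_div_mul_cancel hp.ne', Real.rpow_one]
  have hterm : ∀ i : ℕ, (M / (A * ((2 : ℝ) ^ i) ^ s * ((2 : ℝ) ^ m) ^ (Q / p))) ^ p =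
      κ * ((2 : ℝ) ^ m) ^ (-Q) * (1 - θ) * θ ^ i := by
    intro i
    rw [mul_assoc, ← div_div, Real.div_rpow (by positivity) (by positivity), hAp,
      Real.mul_rpow (by positivity) (by positivity), ← Real.rpow_mul (by positivity),
      ← Real.rpow_mul (by positivity), div_mul_cancel₀ _ hp.ne', hθ, Real.rpow_neg (by positivity),
      Real.rpow_neg (by positivity), inv_pow, ← Real.rpow_natCast ((2 : ℝ) ^ (s * p)),
      ← Real.rpow_natCast 2 i, ← Real.rpow_mul (by positivity), ← Real.rpow_mul (by positivity),
      mul_comm (i : ℝ)]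
    have h1 : (0 : ℝ) < (2 : ℝ) ^ (s * p * i) := by positivity
    have h2 : (0 : ℝ) < ((2 : ℝ) ^ m) ^ Q := by positivity
    field_simp
  have hsub : (goodSet g E s (Q / p) A b m)ᶜ ⊆ E ∪ ⋃ i : ℕ,
      {x | ENNReal.ofReal (A * ((2 : ℝ) ^ i) ^ s * ((2 : ℝ) ^ m) ^ (Q / p)) <
        g ((m : ℤ) - b + i) x} := by
    intro x hx
    by_contra hne
    simp only [Set.mem_union, Set.mem_iUnion, Set.mem_ofPred_eq, not_or, not_exists,
      not_lt] at hne
    exact hx hne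
  calc μ (goodSet g E s (Q / p) A b m)ᶜ
      ≤ μ E + μ (⋃ i : ℕ, {x | ENNReal.ofReal (A * ((2 : ℝ) ^ i) ^ s * ((2 : ℝ) ^ m) ^ (Q / p)) <
        g ((m : ℤ) - b + i) x}) := (measure_mono hsub).trans (measure_union_le _ _)
    _ ≤ ∑' i : ℕ, ENNReal.ofReal (κ * ((2 : ℝ) ^ m) ^ (-Q) * (1 - θ) * θ ^ i) := by
        rw [hE, zero_add]
        refine (measure_iUnion_le _).trans (ENNReal.tsum_le_tsum fun i => ?_)
        rw [← hterm i]
        exact measure_ofReal_lt_le (hg _) hp hM.le (by positivity) (hgM _)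
    _ = ENNReal.ofReal (κ * ((2 : ℝ) ^ m) ^ (-Q)) := by
        rw [← ENNReal.ofReal_tsum_of_nonneg (fun i => by positivity)
          ((summable_geometric_of_lt_one hθ0.le hθ1).mul_left _), tsum_mul_left,
          tsum_geometric_of_lt_one hθ0.le hθ1, mul_assoc, mul_inv_cancel₀ h1θ.ne', mul_one]

end Gradient

/-! ### Multiscale chaining. -/

section Holder

variable {X : Type*} {ρ : X → X → ℝ}

/-- Multiscale chaining: if `u` varies little between close points of the sets `G m`, and `G m`
meets all balls of radius `2 ^ (-m)`, then `u` is Hölder continuous on the set of the points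
that belong to `G m` for arbitrarily large `m`. -/
theorem exists_holder_of_scales (hρ : IsQuasiMetric ρ) {u : X → ℝ} {G : ℕ → Set X}
    {D L σ : ℝ} (hL : 0 ≤ L) (hσ : 0 < σ) {m₀ : ℕ}
    (hD : ∀ (x x' y y' : X) (t : ℝ), ρ x x' ≤ t → ρ x y ≤ t → ρ y y' ≤ t → ρ x' y' ≤ D * t)
    (hG : ∀ m, m₀ ≤ m → ∀ x, ∃ y ∈ G m, ρ x y < 1 / 2 ^ m)
    (hu : ∀ m n, m ≤ n → n ≤ m + 1 → ∀ x ∈ G m, ∀ y ∈ G n, ρ x y ≤ D * (1 / 2 ^ m) →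
      |u x - u y| ≤ L * ((2 : ℝ) ^ m) ^ (-σ)) :
    ∃ C : ℝ, 0 ≤ C ∧ ∀ x y : X, (∃ᶠ m in Filter.atTop, x ∈ G m) →
      (∃ᶠ m in Filter.atTop, y ∈ G m) → ρ x y < 1 / 2 ^ m₀ → |u x - u y| ≤ C * ρ x y ^ σ := by
  set θ : ℝ := (2 : ℝ) ^ (-σ) with hθ
  have hθ0 : 0 < θ := by positivity
  have hθ1 : θ < 1 := Real.rpow_lt_one_of_one_lt_of_neg one_lt_two (by linarith)
  have h1θ : 0 < 1 - θ := by linarith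
  -- The solution of `K * θ + 1 = K`, so that the induction in `tele` reproduces its constant.
  set K : ℝ := (1 - θ)⁻¹ with hK
  have hK0 : 0 < K := by positivity
  have hKθ : K * θ + 1 = K := by rw [hK]; field_simp; ring
  have hK1 : 1 ≤ K := by nlinarith
  have hself : ∀ x, ρ x x = 0 := fun x => (hρ.eq_zero_iff x x).2 rfl
  have hwpos : ∀ m : ℕ, (0 : ℝ) < ((2 : ℝ) ^ m) ^ (-σ) := fun m => by positivity
  have hw : ∀ m : ℕ, ((2 : ℝ) ^ (m + 1)) ^ (-σ) = ((2 : ℝ) ^ m) ^ (-σ) * θ := fun m => by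
    rw [pow_succ, Real.mul_rpow (by positivity) (by positivity)]
  have hhalf : ∀ m : ℕ, (1 : ℝ) / 2 ^ (m + 1) ≤ 1 / 2 ^ m := fun m =>
    one_div_le_one_div_of_le (by positivity) (pow_le_pow_right₀ one_le_two (Nat.le_succ m))
  -- The bound does not depend on `d`, so `x` may be good at any finer level; no limit, hence no
  -- continuity of `u`, is needed.
  have tele : ∀ (d m : ℕ) (x y : X), m₀ ≤ m → x ∈ G (m + d) → y ∈ G m → ρ x y < 1 / 2 ^ m →
      |u x - u y| ≤ L * K * ((2 : ℝ) ^ m) ^ (-σ) := by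
    intro d
    induction d with
    | zero =>
      intro m x y _ hx hy hxy
      have h0 : (0 : ℝ) ≤ 1 / 2 ^ m := by positivity
      have h := hu m m le_rfl (Nat.le_succ m) x hx y hy
        (hD x x x y _ (by rw [hself]; exact h0) (by rw [hself]; exact h0) hxy.le)
      refine h.trans ?_
      have := hwpos m
      gcongr
      nlinarith
    | succ d ih =>
      intro m x y hm hx hy hxy
      have h0 : (0 : ℝ) ≤ 1 / 2 ^ m := by positivity
      obtain ⟨z, hz, hxz⟩ := hG (m + 1) (hm.trans (Nat.le_succ m)) x
      have h1 := ih (m + 1) x z (hm.trans (Nat.le_succ m))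
        (by rwa [show m + 1 + d = m + (d + 1) by ring]) hz hxz
      have h2 := hu m (m + 1) (Nat.le_succ m) le_rfl y hy z hz
        (hD x y x z _ hxy.le (by rw [hself]; exact h0) (hxz.le.trans (hhalf m)))
      rw [hw] at h1
      rw [abs_sub_comm] at h2
      calc |u x - u y| ≤ |u x - u z| + |u z - u y| := abs_sub_le _ _ _
        _ ≤ L * K * (((2 : ℝ) ^ m) ^ (-σ) * θ) + L * ((2 : ℝ) ^ m) ^ (-σ) := add_le_add h1 h2
        _ = L * (K * θ + 1) * ((2 : ℝ) ^ m) ^ (-σ) := by ring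
        _ = L * K * ((2 : ℝ) ^ m) ^ (-σ) := by rw [hKθ]
  have hfar : ∀ (m : ℕ) (x y : X), m₀ ≤ m → (∃ᶠ n in Filter.atTop, x ∈ G n) → y ∈ G m →
      ρ x y < 1 / 2 ^ m → |u x - u y| ≤ L * K * ((2 : ℝ) ^ m) ^ (-σ) := by
    intro m x y hm hx hy hxy
    obtain ⟨n, hn, hxn⟩ := Filter.frequently_atTop.1 hx m
    obtain ⟨d, rfl⟩ := Nat.exists_eq_add_of_le hn
    exact tele d m x y hm hxn hy hxy
  -- `2 * K` comes from the two ends, 1 from the middle link, `2 ^ σ` from `2 ^ (-m) ≤ 2 * ρ x y`.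
  refine ⟨L * (2 * K + 1) * ((2 : ℝ) ^ σ), by positivity, fun x y hx hy hxy => ?_⟩
  rcases (hρ.nonneg x y).eq_or_lt with h | h
  · rw [(hρ.eq_zero_iff x y).1 h.symm, sub_self, abs_zero]
    have := hρ.nonneg y y
    positivity
  obtain ⟨j, hj₁, hj₂⟩ := exists_mem_Ico_zpow h one_lt_two
  have hj : j < -(m₀ : ℤ) := by
    have h' := hj₁.trans_lt hxy
    rw [one_div, ← zpow_natCast, ← zpow_neg] at h'
    exact (zpow_lt_zpow_iff_right₀ one_lt_two).1 h'
  obtain ⟨m, hm⟩ := Int.eq_ofNat_of_zero_le (show 0 ≤ -(j + 1) by omega)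
  have hj' : j + 1 = -(m : ℤ) := by omega
  have hxm : ρ x y < 1 / 2 ^ m := by
    rwa [hj', zpow_neg, zpow_natCast, ← one_div] at hj₂
  have hmx : 1 / 2 ^ m ≤ 2 * ρ x y := by
    have : (1 : ℝ) / 2 ^ m = 2 * 2 ^ j := by
      rw [one_div, ← zpow_natCast, ← zpow_neg, ← hj', zpow_add₀ two_ne_zero, zpow_one, mul_comm]
    rw [this]; linarith
  have hm₀ : m₀ ≤ m := by omega
  obtain ⟨x', hx', hxx'⟩ := hG m hm₀ x
  obtain ⟨y', hy', hyy'⟩ := hG m hm₀ y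
  have h1 := hfar m x x' hm₀ hx hx' hxx'
  have h2 := hfar m y y' hm₀ hy hy' hyy'
  have h3 := hu m m le_rfl (Nat.le_succ m) x' hx' y' hy'
    (hD x x' y y' _ hxx'.le hxm.le hyy'.le)
  have hwm : ((2 : ℝ) ^ m) ^ (-σ) ≤ 2 ^ σ * ρ x y ^ σ := by
    rw [← Real.mul_rpow zero_le_two h.le, Real.rpow_neg (by positivity),
      ← Real.inv_rpow (by positivity), ← one_div]
    exact Real.rpow_le_rpow (by positivity) hmx hσ.le
  rw [abs_sub_comm] at h2
  calc |u x - u y| ≤ |u x - u x'| + |u x' - u y'| + |u y' - u y| :=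
        (abs_sub_le _ (u y') _).trans (by gcongr; exact abs_sub_le _ _ _)
    _ ≤ L * (2 * K + 1) * ((2 : ℝ) ^ m) ^ (-σ) := by linarith
    _ ≤ L * (2 * K + 1) * (2 ^ σ * ρ x y ^ σ) := by gcongr
    _ = _ := by ring

end Holder

/-! ### Triviality of the spaces. -/

section Main

variable {X : Type*} {ρ : X → X → ℝ}

theorem le_lqNorm {q : ℝ≥0∞} (hq : 0 < q) (a : ℤ → ℝ≥0∞) (k : ℤ) : a k ≤ lqNorm q a := by
  unfold lqNorm
  split_ifs with h
  · exact le_iSup a k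
  · have hq' : 0 < q.toReal := ENNReal.toReal_pos hq.ne' h
    calc a k = (a k ^ q.toReal) ^ (1 / q.toReal) := by
          rw [← ENNReal.rpow_mul, mul_one_div_cancel hq'.ne', ENNReal.rpow_one]
      _ ≤ _ := by
          gcongr
          exact ENNReal.le_tsum k

theorem exists_hasSmallChains_lt {t : ℝ} (h : holderIndex ρ < ENNReal.ofReal t) :
    ∃ α : ℝ, 0 < α ∧ α < t ∧ HasSmallChains ρ α := by
  simp only [holderIndex, iInf_lt_iff] at h
  obtain ⟨α, hα, hc, hlt⟩ := h
  exact ⟨α, hα, (ENNReal.ofReal_lt_ofReal_iff_of_nonneg hα.le).1 hlt, hc⟩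

/-- Lower regularity is assumed only for radii up to the diameter, so only scales `m ≥ m₀` are
usable. -/
theorem exists_pow_le_diam [Nontrivial X] (hρ : IsQuasiMetric ρ) :
    ∃ m₀ : ℕ, ∀ m, m₀ ≤ m → ENNReal.ofReal (1 / 2 ^ m) ≤ diam ρ := by
  obtain ⟨x, y, hxy⟩ := exists_pair_ne X
  have hpos : 0 < ρ x y := lt_of_le_of_ne (hρ.nonneg x y)
    fun h => hxy ((hρ.eq_zero_iff x y).1 h.symm)
  obtain ⟨m₀, hm₀⟩ := exists_pow_lt_of_lt_one hpos (show (1 / 2 : ℝ) < 1 by norm_num)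
  refine ⟨m₀, fun m hm => le_trans ?_ (le_iSup₂ (f := fun x y => ENNReal.ofReal (ρ x y)) x y)⟩
  refine ENNReal.ofReal_le_ofReal (le_trans ?_ hm₀.le)
  rw [← one_div_pow]
  exact pow_le_pow_of_le_one (by norm_num) (by norm_num) hm

variable [MeasurableSpace X] {μ : Measure X}

/-- A function with a fractional `s`-gradient whose members are bounded in `L^p` is constant
almost everywhere, if `α`-chains exist for some `α < s - Q / p`. -/
theorem ae_const_of_isFractionalGradient (hX : IsQuasiMetricMeasureSpace ρ μ) {Q : ℝ}
    (hQ : 0 < Q) (hμ : LowerAhlforsRegular ρ μ Q) {s p α : ℝ} (hp : 0 < p) (hα : 0 < α)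
    (hαs : α < s - Q / p) (hc : HasSmallChains ρ α) {u : X → ℝ} {g : ℤ → X → ℝ≥0∞}
    (hg : IsFractionalGradient ρ μ s u g) {M : ℝ≥0∞} (hM : M < ∞)
    (hgM : ∀ k, eLpNorm (g k) (ENNReal.ofReal p) μ ≤ M) :
    ∃ c : ℝ, u =ᵐ[μ] fun _ => c := by
  have hρ := hX.isQuasiMetric
  have := hX.nontrivial
  obtain ⟨hgm, E, hE0, hE⟩ := hg
  obtain ⟨κ, hκ, hκμ⟩ := hμ
  obtain ⟨D, hD, hnear⟩ := hρ.exists_dist_le_of_near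
  obtain ⟨m₀, hm₀⟩ := exists_pow_le_diam hρ
  -- The factor 2 is for the finer level: `D * 2 ^ (-m) < 2 ^ b * 2 ^ (-(m + 1))`.
  obtain ⟨b, hb⟩ := pow_unbounded_of_one_lt (2 * D) one_lt_two
  have hs : 0 < s := by linarith [div_pos hQ hp]
  have hgM' : ∀ k, eLpNorm (g k) (ENNReal.ofReal p) μ ≤ ENNReal.ofReal (M.toReal + 1) :=
    fun k => (hgM k).trans <| by
      rw [← ENNReal.ofReal_toReal hM.ne, ENNReal.toReal_ofReal ENNReal.toReal_nonneg]
      exact ENNReal.ofReal_le_ofReal (by linarith)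
  -- Half of `κ` makes the complement of a good set strictly smaller than any ball of radius `2 ^
  -- (-m)`, `m ≥ m₀`.
  obtain ⟨A, hA, hAμ⟩ := exists_measure_compl_goodSet_le (Q := Q) hgm hE0 hs hp
    (by positivity : 0 < M.toReal + 1) (half_pos hκ) hgM' b
  set G : ℕ → Set X := goodSet g E s (Q / p) A b with hGdef
  set σ : ℝ := s - Q / p with hσ
  have hσ0 : 0 < σ := hα.trans hαs
  have hpow : ∀ m : ℕ, ((2 : ℝ) ^ m) ^ (-Q) = (1 / 2 ^ m) ^ Q := fun m => by
    rw [Real.rpow_neg (by positivity), ← Real.inv_rpow (by positivity), one_div]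
  have hGmeet : ∀ m, m₀ ≤ m → ∀ x, ∃ y ∈ G m, ρ x y < 1 / 2 ^ m := by
    intro m hm x
    by_contra! hne
    have hsub : ball ρ x (1 / 2 ^ m) ⊆ (G m)ᶜ := fun y hy hyG => (hne y hyG).not_gt hy
    have h1 := (hκμ x (1 / 2 ^ m) (by positivity) (hm₀ m hm)).trans
      ((measure_mono hsub).trans (hAμ m))
    rw [hpow, ENNReal.ofReal_le_ofReal_iff (by positivity)] at h1
    have h2 : (0 : ℝ) < (1 / 2 ^ m) ^ Q := by positivity
    nlinarith
  have hL : 0 ≤ 2 * (A * ((2 : ℝ) ^ b) ^ s) := by positivity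
  have hGu : ∀ m n, m ≤ n → n ≤ m + 1 → ∀ x ∈ G m, ∀ y ∈ G n, ρ x y ≤ D * (1 / 2 ^ m) →
      |u x - u y| ≤ 2 * (A * ((2 : ℝ) ^ b) ^ s) * ((2 : ℝ) ^ m) ^ (-σ) := by
    intro m n hmn hnm x hx y hy hxy
    have hn : ρ x y < 2 ^ b / 2 ^ n := by
      refine hxy.trans_lt ?_
      have h2n : (2 : ℝ) ^ n ≤ 2 * 2 ^ m := by
        rw [← pow_succ']; exact pow_le_pow_right₀ one_le_two hnm
      rw [mul_one_div, div_lt_div_iff₀ (by positivity) (by positivity)]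
      calc D * 2 ^ n ≤ D * (2 * 2 ^ m) := by gcongr
        _ = 2 * D * 2 ^ m := by ring
        _ < 2 ^ b * 2 ^ m := by gcongr
    have hm : ρ x y < 2 ^ b / 2 ^ m := hn.trans_le (by gcongr; norm_num)
    have h := abs_sub_le_of_mem_goodSet hρ hs.le hA.le hE hx hy hm hn
    rw [show Q / p - s = -σ by rw [hσ]; ring] at h
    have hw : ((2 : ℝ) ^ n) ^ (-σ) ≤ ((2 : ℝ) ^ m) ^ (-σ) :=
      Real.rpow_le_rpow_of_nonpos (by positivity) (pow_le_pow_right₀ one_le_two hmn)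
        (by linarith)
    have : A * ((2 : ℝ) ^ b) ^ s * ((2 : ℝ) ^ n) ^ (-σ) ≤
        A * ((2 : ℝ) ^ b) ^ s * ((2 : ℝ) ^ m) ^ (-σ) := by gcongr
    linarith
  obtain ⟨C, hC, hHolder⟩ := exists_holder_of_scales hρ hL hσ0 hnear hGmeet hGu
  set S : Set X := {x | ∃ᶠ m in Filter.atTop, x ∈ G m} with hS
  have hSae : ∀ᵐ x ∂μ, x ∈ S := by
    have hsum : ∑' m : ℕ, μ (G m)ᶜ ≠ ∞ := by
      have hθ0 : (0 : ℝ) ≤ 2 ^ (-Q) := by positivity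
      have hθ1 : (2 : ℝ) ^ (-Q) < 1 :=
        Real.rpow_lt_one_of_one_lt_of_neg one_lt_two (by linarith)
      have hterm : ∀ m : ℕ, ((2 : ℝ) ^ m) ^ (-Q) = ((2 : ℝ) ^ (-Q)) ^ m := fun m => by
        rw [← Real.rpow_natCast 2 m, ← Real.rpow_natCast _ m, ← Real.rpow_mul zero_le_two,
          ← Real.rpow_mul zero_le_two, mul_comm]
      refine ne_top_of_le_ne_top ?_ (ENNReal.tsum_le_tsum hAμ)
      simp only [hterm]
      exact ((summable_geometric_of_lt_one hθ0 hθ1).mul_left _).tsum_ofReal_ne_top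
    filter_upwards [ae_eventually_notMem hsum] with x hx
    exact (hx.mono fun m hm => Set.notMem_compl_iff.1 hm).frequently
  have hSmeet : ∀ x r, 0 < r → ∃ y ∈ S, ρ x y < r := by
    intro x r hr
    by_contra! hne
    have hsub : ball ρ x r ⊆ Sᶜ := fun y hy hyS => (hne y hyS).not_gt hy
    exact (hX.measure_ball_pos x r hr).ne' (measure_mono_null hsub hSae)
  obtain ⟨x₀, hx₀, -⟩ := hSmeet (Classical.arbitrary X) 1 one_pos
  refine ⟨u x₀, ?_⟩
  filter_upwards [hSae] with x hx
  exact eq_of_holder_of_hasSmallChains hρ hα hαs.le hc hSmeet hC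
    (by positivity : (0 : ℝ) < 1 / 2 ^ m₀) (fun x hx y hy hxy => hHolder x y hx hy hxy) hx hx₀

end Main

end QuasiMetric

theorem mainTheorem8 {X : Type*} [MeasurableSpace X] (ρ : X → X → ℝ) (μ : Measure X)
    (hX : QuasiMetric.IsQuasiMetricMeasureSpace ρ μ)
    (Q : ℝ) (hQ : 0 < Q) (hμ : QuasiMetric.LowerAhlforsRegular ρ μ Q)
    (s p : ℝ) (q : ℝ≥0∞)
    (hs : QuasiMetric.holderIndex ρ < ENNReal.ofReal s)
    (hp : Q / (s - (QuasiMetric.holderIndex ρ).toReal) < p)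
    (hq : 0 < q) :
    (∀ u ∈ QuasiMetric.HajlaszTriebelLizorkin ρ μ s p q, ∃ c : ℝ, u =ᵐ[μ] fun _ => c) ∧
    (∀ u ∈ QuasiMetric.HajlaszBesov ρ μ s p q, ∃ c : ℝ, u =ᵐ[μ] fun _ => c) := by
  have hfin : QuasiMetric.holderIndex ρ ≠ ∞ := (hs.trans_le le_top).ne
  have hsh : 0 < s - (QuasiMetric.holderIndex ρ).toReal :=
    sub_pos.2 ((ENNReal.lt_ofReal_iff_toReal_lt hfin).1 hs)
  have hp0 : 0 < p := (div_pos hQ hsh).trans hp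
  have hlt : QuasiMetric.holderIndex ρ < ENNReal.ofReal (s - Q / p) := by
    rw [ENNReal.lt_ofReal_iff_toReal_lt hfin]
    rw [div_lt_iff₀ hsh, ← div_lt_iff₀' hp0] at hp
    linarith
  obtain ⟨α, hα, hαs, hc⟩ := QuasiMetric.exists_hasSmallChains_lt hlt
  constructor
  · rintro u ⟨-, hu⟩
    simp only [iInf_lt_iff] at hu
    obtain ⟨g, hg, hgq⟩ := hu
    refine QuasiMetric.ae_const_of_isFractionalGradient hX hQ hμ hp0 hα hαs hc hg hgq fun k => ?_
    exact eLpNorm_mono_enorm fun x => QuasiMetric.le_lqNorm hq (fun k => g k x) k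
  · rintro u ⟨-, hu⟩
    simp only [iInf_lt_iff] at hu
    obtain ⟨g, hg, hgq⟩ := hu
    exact QuasiMetric.ae_const_of_isFractionalGradient hX hQ hμ hp0 hα hαs hc hg hgq fun k =>
      QuasiMetric.le_lqNorm hq (fun k => eLpNorm (g k) (ENNReal.ofReal p) μ) k
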